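/- Let $\Gamma=(V,E)$ be a connected finite simple graph with $n$ vertices, let $v\in V$, and let $\Gamma_v$ be the graph obtained from $\Gamma$ by deleting $v$ and all edges incident to $v$. Let $W_v=(\mathbb{C}^2)^{\otimes (V\setminus\{v\})}$, a Hilbert space of dimension $2^{n-1}$, and for $w\in V\setminus\{v\}$ let $X_w, Z_w$ be the Pauli operators acting on the tensor factor $w$ of $W_v$. Consider the following real Lie algebras of operators on $W_v$, generated under the commutator: - the free dynamical Lie algebra (DLA) of $\Gamma_v$, $$\mathfrak g_{\Gamma_v,\mathrm{free}}=\big\langle \{iX_w : w\in V\setminus\{v\}\},\ \{iZ_wZ_{w'} : \{w,w'\}\in E(\Gamma_v)\}\big\rangle_{\mathrm{Lie}};$$ - the free reduced DLA, $$\mathfrak g^{v}_{\Gamma,\mathrm{free}}=\big\langle \{iX_w : w\in V\setminus\{v\}\},\ \{iZ_wZ_{w'} : \{w,w'\}\in E(\Gamma_v)\},\ \{iZ_w : \{v,w\}\in E\}\big\rangle_{\mathrm{Lie}};$$ - the standard reduced DLA, $$\mathfrak g^{v}_{\Gamma,\mathrm{std}}=\Big\langle\, i\!\!\sum_{w\in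 V\setminus\{v\}}\!\! X_w,\ \ i\Big(\sum_{\{w,w'\}\in E(\Gamma_v)} Z_wZ_{w'}+\sum_{\{v,w\}\in E} Z_w\Big)\Big\rangle_{\mathrm{Lie}}.$$ Suppose that $\Gamma_v$ is connected and is neither bipartite nor a cycle, and that $\mathfrak g_{\Gamma_v,\mathrm{free}}\subseteq \mathfrak g^{v}_{\Gamma,\mathrm{std}}$. Then $$\mathfrak g^{v}_{\Gamma,\mathrm{std}}=\mathfrak g^{v}_{\Gamma,\mathrm{free}},$$ and $\mathfrak g^{v}_{\Gamma,\mathrm{std}}$ is isomorphic, as a real Lie algebra, to $\mathfrak{su}(W_v)\cong\mathfrak{su}(2^{n-1})$, where $\mathfrak{su}(W_v)$ is the Lie algebra of traceless skew-Hermitian operators on $W_v$. -/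

import Mathlib

attribute [local instance 100] LieRing.ofAssociativeRing

/-- The Lie algebra `su(ι)`, a real Lie algebra under the commutator: traceless skew-Hermitian
complex matrices with rows and columns indexed by `ι`, that is, traceless skew-Hermitian operators
on the Hilbert space with orthonormal basis indexed by `ι`. -/
def su (ι : Type*) [Fintype ι] [DecidableEq ι] : LieSubalgebra ℝ (Matrix ι ι ℂ) where
  carrier := {A | A.conjTranspose = -A ∧ A.trace = 0}
  zero_mem' := by simp
  add_mem' := by
    rintro A B ⟨hA, hA'⟩ ⟨hB, hB'⟩
    refine ⟨?_, ?_⟩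
    · rw [Matrix.conjTranspose_add, hA, hB, neg_add]
    · rw [Matrix.trace_add, hA', hB', add_zero]
  smul_mem' := by
    rintro c A ⟨hA, hA'⟩
    refine ⟨?_, ?_⟩
    · rw [Matrix.conjTranspose_smul, hA, star_trivial, smul_neg]
    · rw [Matrix.trace_smul, hA', smul_zero]
  lie_mem' := by
    rintro A B ⟨hA, -⟩ ⟨hB, -⟩
    refine ⟨?_, ?_⟩
    · rw [Ring.lie_def, Matrix.conjTranspose_sub, Matrix.conjTranspose_mul,
        Matrix.conjTranspose_mul, hA, hB]
      simp
    · rw [Ring.lie_def, Matrix.trace_sub, Matrix.trace_mul_comm, sub_self]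

/-- Bit strings on a set `U` of qubits; they label the computational basis of `(ℂ²)^{⊗ U}`. -/
abbrev BitString (U : Type*) := U → Fin 2

/-- Linear operators on the Hilbert space `(ℂ²)^{⊗ U}`, written as matrices in the
computational basis. -/
abbrev QubitOp (U : Type*) := Matrix (BitString U) (BitString U) ℂ

section Pauli

variable {U : Type*} [Fintype U] [DecidableEq U]

/-- The single-qubit operator `A` acting on the tensor factor `w`, tensored with the identity on
all the other factors. -/
noncomputable def onQubit (w : U) (A : Matrix (Fin 2) (Fin 2) ℂ) : QubitOp U :=
  Matrix.of fun x y => if ∀ u, u ≠ w → x u = y u then A (x w) (y w) else 0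

/-- The Pauli operator `X_w`. -/
noncomputable def pauliX (w : U) : QubitOp U := onQubit w !![0, 1; 1, 0]

/-- The Pauli operator `Z_w`. -/
noncomputable def pauliZ (w : U) : QubitOp U := onQubit w !![1, 0; 0, -1]

theorem pauliZ_eq_diagonal (w : U) :
    pauliZ w = Matrix.diagonal (fun x : BitString U => if x w = 0 then (1 : ℂ) else -1) := by
  ext x y
  by_cases h : x = y
  · subst h
    have hx : x w = 0 ∨ x w = 1 := by omega
    rcases hx with hx | hx <;> simp [pauliZ, onQubit, hx]
  · rw [Matrix.diagonal_apply_ne _ h]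
    simp only [pauliZ, onQubit, Matrix.of_apply]
    split_ifs with h'
    · have hw : x w ≠ y w := by
        intro hw
        refine h (funext fun u => ?_)
        by_cases hu : u = w
        · rw [hu, hw]
        · exact h' u hu
      have hx : x w = 0 ∨ x w = 1 := by omega
      have hy : y w = 0 ∨ y w = 1 := by omega
      rcases hx with hx | hx <;> rcases hy with hy | hy <;> simp_all
    · rfl

theorem pauliZ_mul_comm (w w' : U) : pauliZ w * pauliZ w' = pauliZ w' * pauliZ w := by
  rw [pauliZ_eq_diagonal, pauliZ_eq_diagonal, Matrix.diagonal_mul_diagonal,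
    Matrix.diagonal_mul_diagonal]
  simp only [mul_comm]

/-- The operator `Z_w Z_{w'}` attached to an unordered pair `{w, w'}`. -/
noncomputable def pauliZZ : Sym2 U → QubitOp U :=
  Sym2.lift ⟨fun w w' => pauliZ w * pauliZ w', pauliZ_mul_comm⟩

end Pauli

/-- The free dynamical Lie algebra of MaxCut on the graph `G`: the real Lie algebra generated by
all `i X_w`, for vertices `w`, and all `i Z_w Z_{w'}`, for edges `{w, w'}`. -/
noncomputable def freeDLA {U : Type*} [Fintype U] [DecidableEq U] (G : SimpleGraph U) :
    LieSubalgebra ℝ (QubitOp U) :=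
  LieSubalgebra.lieSpan ℝ (QubitOp U)
    ({A | ∃ w : U, A = Complex.I • pauliX w} ∪
      {A | ∃ e ∈ G.edgeSet, A = Complex.I • pauliZZ e})

/-- The reduced graph `G_v`: the vertex `v` is removed together with all its edges. -/
abbrev reducedGraph {V : Type*} (G : SimpleGraph V) (v : V) : SimpleGraph {w : V // w ≠ v} :=
  G.comap Subtype.val

section Reduced

variable {V : Type*} [Fintype V] [DecidableEq V]

/-- The reduced mixer Hamiltonian, the sum of all `X_w` with `w ≠ v`, acting on the reduced
Hilbert space `W_v = (ℂ²)^{⊗ (V \ {v})}`. -/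
noncomputable def reducedMixer (v : V) : QubitOp {w : V // w ≠ v} := ∑ w : {w : V // w ≠ v}, pauliX w

/-- The reduced problem Hamiltonian of MaxCut on `G`: the sum of `Z_w Z_{w'}` over the edges of `G`
that avoid `v`, plus the sum of `Z_w` over the neighbours `w` of `v`. -/
noncomputable def reducedProblem (G : SimpleGraph V) [DecidableRel G.Adj] (v : V) : QubitOp {w : V // w ≠ v} :=
  (∑ e ∈ (reducedGraph G v).edgeFinset, pauliZZ e) +
    (∑ w : {w : V // w ≠ v} with G.Adj v w.1, pauliZ w)

/-- The standard reduced dynamical Lie algebra of `G` at `v`. -/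
noncomputable def stdReducedDLA (G : SimpleGraph V) [DecidableRel G.Adj] (v : V) :
    LieSubalgebra ℝ (QubitOp {w : V // w ≠ v}) :=
  LieSubalgebra.lieSpan ℝ (QubitOp {w : V // w ≠ v})
    {Complex.I • reducedMixer v, Complex.I • reducedProblem G v}

/-- The free reduced dynamical Lie algebra of `G` at `v`. -/
noncomputable def freeReducedDLA (G : SimpleGraph V) (v : V) : LieSubalgebra ℝ (QubitOp {w : V // w ≠ v}) :=
  LieSubalgebra.lieSpan ℝ (QubitOp {w : V // w ≠ v})
    ({A | ∃ w : {w : V // w ≠ v}, A = Complex.I • pauliX w} ∪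
      {A | ∃ e ∈ (reducedGraph G v).edgeSet, A = Complex.I • pauliZZ e} ∪
      {A | ∃ w : {w : V // w ≠ v}, G.Adj v w.1 ∧ A = Complex.I • pauliZ w})

end Reduced

/-- `H` is a cycle: it is isomorphic to the cycle graph `C_m` for some `m ≥ 3`. -/
def IsCycleGraph {U : Type*} (H : SimpleGraph U) : Prop :=
  ∃ m : ℕ, 3 ≤ m ∧ Nonempty (H ≃g SimpleGraph.cycleGraph m)

/-! Up to phases, Pauli strings are labelled by pairs `(x, z)` of vectors over the field with two
elements. Two skew-Hermitian strings commute if the symplectic product of their labels is 0;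
otherwise their bracket is a nonzero real multiple of the string labelled by the sum. Generation
thus becomes combinatorics of label sets closed under anticommuting sums
(`isPauliClosed_of_freeDLA_le`).

The core is `IsPauliClosed.mem_of_ne_zero`: over a connected non-bipartite graph, one extra label
`Z_r` yields every nonzero label. The `X`-strings act as sets of tokens that move freely on the
graph; branching produces three tokens, and an odd closed walk removes the last parity obstruction.
Since `v` has a neighbour `r`, the free reduced DLA contains all non-identity strings, and these
span `su`.

For the standard reduced DLA, removing the edge terms from the problem Hamiltonian leaves the sum of
`i Z_w` over the neighbours of `v`; bracketing twice with `i X_w` isolates each summand. -/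

open Matrix

/-! ### Distance levels, branching and odd walks in connected non-bipartite graphs. -/

section Combinatorics

variable {U : Type*}

theorem zmodTwo_add_self (x : U → ZMod 2) : x + x = 0 :=
  funext fun _ => CharTwo.add_self_eq_zero _

theorem zmodTwo_eq_zero_or_one (a : ZMod 2) : a = 0 ∨ a = 1 := by
  revert a; decide

theorem zmodTwo_one_add_one : (1 + 1 : ZMod 2) = 0 := rfl

/-- Otherwise the parity of the distance to `r` would be a proper 2-colouring, since distances of
adjacent vertices differ by at most one. -/
theorem SimpleGraph.exists_adj_dist_eq {H : SimpleGraph U} (hH : ¬ H.IsBipartite)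
    (r : U) : ∃ u u', H.Adj u u' ∧ H.dist r u = H.dist r u' := by
  by_contra! h
  refine hH ⟨SimpleGraph.Coloring.mk
    (fun u => (⟨H.dist r u % 2, Nat.mod_lt _ two_pos⟩ : Fin 2)) ?_⟩
  intro u u' huu' heq
  simp only [Fin.mk.injEq] at heq
  have h1 := h u u' huu'
  rcases huu'.diff_dist_adj (u := r) with h2 | h2 | h2 <;> omega

theorem SimpleGraph.Connected.exists_adj_dist_succ {H : SimpleGraph U} (hc : H.Connected)
    {r u : U} {k : ℕ} (h : H.dist r u = k + 1) : ∃ p, H.Adj p u ∧ H.dist r p = k := by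
  obtain ⟨p, hp⟩ := hc.exists_walk_length_eq_dist u r
  cases p with
  | nil => simp at h
  | cons hadj q =>
    rename_i p
    rw [SimpleGraph.Walk.length_cons, SimpleGraph.dist_comm, h] at hp
    refine ⟨p, hadj.symm, ?_⟩
    have h1 := SimpleGraph.dist_le q
    rw [SimpleGraph.dist_comm] at h1
    rcases hadj.diff_dist_adj (u := r) with h2 | h2 | h2 <;> omega

/-- A connected graph that is not bipartite has a vertex of degree at least three, unless it has
at least two edges at any prescribed vertex. -/
theorem SimpleGraph.exists_branching {H : SimpleGraph U} (hH : ¬ H.IsBipartite)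
    (hc : H.Connected) (r : U) :
    (∃ p q, H.Adj r p ∧ H.Adj r q ∧ p ≠ q) ∨
    (∃ c d p q, H.Adj c d ∧ H.Adj c p ∧ H.Adj c q ∧ d ≠ p ∧ d ≠ q ∧ p ≠ q) := by
  by_contra! hcon
  obtain ⟨h1, h2⟩ := hcon
  -- Without branching every distance level is a single vertex, which rules out an edge inside a
  -- level.
  have level : ∀ k u u', H.dist r u = k → H.dist r u' = k → u = u' := by
    intro k
    induction k with
    | zero =>
      intro u u' h h'
      rw [hc.dist_eq_zero_iff] at h h'
      exact h.symm.trans h'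
    | succ k ih =>
      intro u u' h h'
      obtain ⟨p, hp, hpk⟩ := hc.exists_adj_dist_succ h
      obtain ⟨p', hp', hpk'⟩ := hc.exists_adj_dist_succ h'
      obtain rfl := ih p p' hpk hpk'
      by_contra hne
      cases k with
      | zero =>
        rw [hc.dist_eq_zero_iff] at hpk
        subst hpk
        exact hne (h1 u u' hp hp')
      | succ k =>
        obtain ⟨d, hd, hdk⟩ := hc.exists_adj_dist_succ hpk
        refine hne (h2 p d u u' hd.symm hp hp' ?_ ?_)
        · rintro rfl; omega
        · rintro rfl; omega
  obtain ⟨u, u', hadj, hd⟩ := SimpleGraph.exists_adj_dist_eq hH r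
  exact hadj.ne (level _ u u' hd rfl)

/-- Two geodesics from `r` of equal length, closed up by an edge inside a distance level. -/
theorem SimpleGraph.exists_odd_closed_walk {H : SimpleGraph U} (hH : ¬ H.IsBipartite)
    (hc : H.Connected) (r : U) : ∃ p : H.Walk r r, Odd p.length := by
  obtain ⟨u, u', hadj, hd⟩ := SimpleGraph.exists_adj_dist_eq hH r
  obtain ⟨p, hp⟩ := hc.exists_walk_length_eq_dist r u
  obtain ⟨p', hp'⟩ := hc.exists_walk_length_eq_dist r u'
  refine ⟨p.append (SimpleGraph.Walk.cons hadj p'.reverse), ?_⟩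
  rw [SimpleGraph.Walk.length_append, SimpleGraph.Walk.length_cons,
    SimpleGraph.Walk.length_reverse, hp, hp', hd]
  exact ⟨H.dist r u', by ring⟩

/-! ### Label sets closed under anticommuting sums. -/

variable [Fintype U] [DecidableEq U]

/-- A set of labels `(x, z)` of Pauli strings `X^x Z^z` that is closed under sums of anticommuting
labels and contains the labels of all `X_w` and of all `Z_w Z_u` for edges `{w, u}` of `H`. -/
structure IsPauliClosed (H : SimpleGraph U) (A : Set ((U → ZMod 2) × (U → ZMod 2))) : Prop where
  add_mem : ∀ {x z x' z' : U → ZMod 2}, (x, z) ∈ A → (x', z') ∈ A →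
    x ⬝ᵥ z' + z ⬝ᵥ x' = 1 → (x + x', z + z') ∈ A
  x_mem : ∀ w, (Pi.single w 1, 0) ∈ A
  zz_mem : ∀ {w u}, H.Adj w u → (0, Pi.single w 1 + Pi.single u 1) ∈ A

namespace IsPauliClosed

variable {H : SimpleGraph U} {A : Set ((U → ZMod 2) × (U → ZMod 2))}

theorem add_mem' (hA : IsPauliClosed H A) {x z x' z' y t : U → ZMod 2} (h : (x, z) ∈ A)
    (h' : (x', z') ∈ A) (hω : x ⬝ᵥ z' + z ⬝ᵥ x' = 1) (hy : y = x + x') (ht : t = z + z') :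
    (y, t) ∈ A := by
  rw [hy, ht]; exact hA.add_mem h h' hω

theorem toggle (hA : IsPauliClosed H A) {x z : U → ZMod 2} (h : (x, z) ∈ A) {w : U}
    (hw : z w = 1) : (x + Pi.single w 1, z) ∈ A :=
  hA.add_mem' h (hA.x_mem w) (by simp [hw]) rfl (by simp)

/-- The value of `x` at a vertex of the `Z`-support can be prescribed. -/
theorem exists_toggle (hA : IsPauliClosed H A) {x z : U → ZMod 2} (h : (x, z) ∈ A) {w : U}
    (hw : z w = 1) (a : ZMod 2) :
    (x + Pi.single w (x w + a), z) ∈ A := by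
  rcases zmodTwo_eq_zero_or_one (x w + a) with h0 | h0
  · simpa [h0] using h
  · rw [h0]; exact hA.toggle h hw

/-- Transporting a string with `Z`-support one vertex along an edge. -/
theorem step (hA : IsPauliClosed H A) {x : U → ZMod 2} {w u : U} (h : (x, Pi.single w 1) ∈ A)
    (hwu : H.Adj w u) : ∃ y : U → ZMod 2, (y, Pi.single u 1) ∈ A ∧
      ∑ i, y i + y u = ∑ i, x i + x w + 1 := by
  have hne : u ≠ w := hwu.ne'
  -- With the value `1 + x u` at `w`, exactly one endpoint carries an `X`, so the string
  -- anticommutes with `Z_w Z_u`.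
  have h1 := hA.exists_toggle h (w := w) (by simp) (1 + x u)
  refine ⟨x + Pi.single w (x w + (1 + x u)), hA.add_mem' h1 (hA.zz_mem hwu) ?_ (by simp) ?_, ?_⟩
  · simp only [dotProduct_add, dotProduct_single, Pi.add_apply, Pi.single_eq_same,
      Pi.single_eq_of_ne hne, dotProduct_zero, mul_one, add_zero]
    linear_combination CharTwo.add_self_eq_zero (x w) + CharTwo.add_self_eq_zero (x u)
  · linear_combination -zmodTwo_add_self (Pi.single w 1 : U → ZMod 2)
  · simp only [Pi.add_apply, Finset.sum_add_distrib, Pi.single_eq_of_ne hne, Finset.sum_pi_single']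
    simp
    linear_combination CharTwo.add_self_eq_zero (x u)

/-- The tracked sum is the parity of the `X`-support away from the `Z`-vertex; each edge flips it.
-/
theorem walk (hA : IsPauliClosed H A) {w u : U} (p : H.Walk w u) :
    ∀ {x : U → ZMod 2}, (x, Pi.single w 1) ∈ A → ∃ y : U → ZMod 2, (y, Pi.single u 1) ∈ A ∧
      ∑ i, y i + y u = ∑ i, x i + x w + p.length := by
  induction p with
  | nil => intro x h; exact ⟨x, h, by simp⟩
  | cons hadj p ih =>
    intro x h
    obtain ⟨y, hy, hs⟩ := hA.step h hadj
    obtain ⟨y', hy', hs'⟩ := ih hy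
    refine ⟨y', hy', ?_⟩
    rw [hs', hs, SimpleGraph.Walk.length_cons]
    push_cast
    ring

/-- A token of an `X`-string hops along an edge to a free vertex. -/
theorem hop (hA : IsPauliClosed H A) {x : U → ZMod 2} {c e : U} (h : (x, 0) ∈ A)
    (hce : H.Adj c e) (hc : x c = 1) (he : x e = 0) :
    (x + Pi.single c 1 + Pi.single e 1, 0) ∈ A := by
  have hne := hce.ne
  have h1 : (x, Pi.single c 1 + Pi.single e 1) ∈ A :=
    hA.add_mem' h (hA.zz_mem hce) (by simp [hc, he]) (by simp) (by simp)
  have h2 := hA.toggle (hA.toggle h1 (w := c) (by simp [hne])) (w := e) (by simp [hne.symm])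
  refine hA.add_mem' h2 (hA.zz_mem hce) ?_ (by simp) (zmodTwo_add_self _).symm
  simp [hc, he, hne, hne.symm]
  rfl

/-- A token of an `X`-string moves to any free vertex. -/
theorem move (hA : IsPauliClosed H A) {c e : U} (p : H.Walk c e) :
    ∀ {x : U → ZMod 2}, (x, 0) ∈ A → x c = 1 → x e = 0 →
      (x + Pi.single c 1 + Pi.single e 1, 0) ∈ A := by
  induction p with
  | nil => intro x _ h h'; rw [h] at h'; exact absurd h' one_ne_zero
  | @cons c f e hadj p ih =>
    intro x h hc he
    have hne := hadj.ne
    have hce : c ≠ e := by rintro rfl; rw [hc] at he; exact one_ne_zero he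
    rcases zmodTwo_eq_zero_or_one (x f) with hf | hf
    · have h1 := hA.hop h hadj hc hf
      by_cases hfe : f = e
      · subst hfe; exact h1
      have h2 := ih h1 (by simp [hf, hne.symm]) (by simp [he, hce.symm, Ne.symm hfe])
      convert h2 using 2
      linear_combination -zmodTwo_add_self (Pi.single f 1 : U → ZMod 2)
    -- Tokens are indistinguishable: if `f` is occupied, its token goes on to `e` and the one at `c`
    -- takes its place.
    · have hfe : f ≠ e := by rintro rfl; rw [hf] at he; exact one_ne_zero he
      have h1 := ih h hf he
      have h2 := hA.hop h1 hadj (by simp [hc, hne, hce])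
        (by simp [hf, hfe]; rfl)
      convert h2 using 2
      linear_combination -zmodTwo_add_self (Pi.single f 1 : U → ZMod 2)

theorem move_finset (hA : IsPauliClosed H A) (hc : H.Connected) (S' : Finset U) (k : ℕ) :
    ∀ S : Finset U, (S' \ S).card = k → S.card = S'.card →
      ((fun i => if i ∈ S then 1 else 0 : U → ZMod 2), (0 : U → ZMod 2)) ∈ A →
      ((fun i => if i ∈ S' then 1 else 0 : U → ZMod 2), (0 : U → ZMod 2)) ∈ A := by
  induction k with
  | zero =>
    intro S h hcard hS
    rw [Finset.card_eq_zero, Finset.sdiff_eq_empty_iff_subset] at h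
    rwa [Finset.eq_of_subset_of_card_le h hcard.le]
  | succ k ih =>
    intro S h hcard hS
    obtain ⟨e, he⟩ : (S' \ S).Nonempty := by rw [← Finset.card_pos]; omega
    obtain ⟨c, hcS⟩ : (S \ S').Nonempty := by
      rw [← Finset.card_pos]
      have := Finset.card_sdiff_add_card S S'
      have := Finset.card_sdiff_add_card S' S
      rw [Finset.union_comm] at this
      omega
    rw [Finset.mem_sdiff] at he hcS
    have hce : c ≠ e := by rintro rfl; exact he.2 hcS.1
    obtain ⟨p⟩ := hc.preconnected c e
    have h1 := hA.move p hS (by simp [hcS.1]) (by simp [he.2])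
    refine ih (insert e (S.erase c)) ?_ ?_ ?_
    · have : S' \ insert e (S.erase c) = (S' \ S).erase e := by
        ext i
        simp only [Finset.mem_sdiff, Finset.mem_insert, Finset.mem_erase]
        by_cases hi : i = c
        · subst hi; simp [hcS.2]
        · tauto
      rw [this, Finset.card_erase_of_mem (by simp [he]), h]; rfl
    · rw [Finset.card_insert_of_notMem (by simp [he.2]), Finset.card_erase_of_mem hcS.1, ← hcard]
      have := Finset.card_pos.2 ⟨c, hcS.1⟩
      omega
    · convert h1 using 2
      funext i
      by_cases hi : i = e
      · subst hi; simp [he.2, hce.symm]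
      · by_cases hi' : i = c
        · subst hi'; simp [hcS.1, hce]; rfl
        · simp [hi, hi']

/-- Bracketing `X_c` with the three edges gives a `Z`-part supported on `c, d, p, q`. Toggling `X`
at the three leaves gives a second string with the same `Z`-part; three being odd, the two
anticommute, and their sum has only the leaves. -/
theorem star (hA : IsPauliClosed H A) {c d p q : U} (hd : H.Adj c d) (hp : H.Adj c p)
    (hq : H.Adj c q) (hdp : d ≠ p) (hdq : d ≠ q) (hpq : p ≠ q) :
    (Pi.single d 1 + Pi.single p 1 + Pi.single q 1, 0) ∈ A := by
  have hcd := hd.ne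
  have hcp := hp.ne
  have hcq := hq.ne
  have h1 : (Pi.single c 1, Pi.single c 1 + Pi.single p 1 + (Pi.single c 1 + Pi.single q 1) +
      (Pi.single c 1 + Pi.single d 1)) ∈ A := by
    refine hA.add_mem' (hA.add_mem' (hA.add_mem' (hA.x_mem c) (hA.zz_mem hp) ?_ rfl rfl)
      (hA.zz_mem hq) ?_ rfl rfl) (hA.zz_mem hd) ?_ (by simp) (by ring) <;>
    simp [hcd, hcp, hcq]
  have h3 := hA.toggle (hA.toggle (hA.toggle h1 (w := d)
    (by simp [hcd.symm, hdp, hdq]))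
    (w := p) (by simp [hcp.symm, hdp.symm, hpq]))
    (w := q) (by simp [hcq.symm, hdq.symm, hpq.symm])
  refine hA.add_mem' h1 h3 ?_ ?_ (zmodTwo_add_self _).symm
  · simp [hcd, hcp, hcq, hcd.symm, hcp.symm, hcq.symm, hdp, hdp.symm, hdq, hdq.symm, hpq, hpq.symm]
    decide
  · linear_combination -zmodTwo_add_self (Pi.single c 1 : U → ZMod 2)

/-- As in `star`, with `Z_c` replacing the third edge and the toggles at `c, p, q`. -/
theorem star' (hA : IsPauliClosed H A) {c p q : U} (hc : (0, Pi.single c 1) ∈ A) (hp : H.Adj c p)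
    (hq : H.Adj c q) (hpq : p ≠ q) :
    (Pi.single c 1 + Pi.single p 1 + Pi.single q 1, 0) ∈ A := by
  have hcp := hp.ne
  have hcq := hq.ne
  have h1 : (Pi.single c 1, Pi.single c 1 + Pi.single p 1 + (Pi.single c 1 + Pi.single q 1) +
      Pi.single c 1) ∈ A := by
    refine hA.add_mem' (hA.add_mem' (hA.add_mem' (hA.x_mem c) (hA.zz_mem hp) ?_ rfl rfl)
      (hA.zz_mem hq) ?_ rfl rfl) hc ?_ (by simp) (by ring) <;>
    simp [hcp, hcq]
  have h3 := hA.toggle (hA.toggle (hA.toggle h1 (w := c) (by simp [hcp, hcq]; decide))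
    (w := p) (by simp [hcp.symm, hpq]))
    (w := q) (by simp [hcq.symm, hpq.symm])
  refine hA.add_mem' h1 h3 ?_ ?_ (zmodTwo_add_self _).symm
  · simp [hcp, hcq, hcp.symm, hcq.symm, hpq, hpq.symm]
    decide
  · linear_combination -zmodTwo_add_self (Pi.single c 1 : U → ZMod 2)

theorem triple_mem (hA : IsPauliClosed H A) (hc : H.Connected) (hH : ¬ H.IsBipartite) {r : U}
    (hr : (0, Pi.single r 1) ∈ A) {a b c : U} (hab : a ≠ b) (hac : a ≠ c) (hbc : b ≠ c) :
    (Pi.single a 1 + Pi.single b 1 + Pi.single c 1, 0) ∈ A := by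
  have ind : ∀ {a b c : U}, a ≠ b → a ≠ c → b ≠ c →
      (fun i => if i ∈ ({a, b, c} : Finset U) then 1 else 0 : U → ZMod 2) =
        Pi.single a 1 + Pi.single b 1 + Pi.single c 1 := by
    intro a b c hab hac hbc
    funext i
    simp only [Finset.mem_insert, Finset.mem_singleton, Pi.add_apply, Pi.single_apply]
    by_cases h1 : i = a
    · subst h1; simp [hab, hac]
    · by_cases h2 : i = b
      · subst h2; simp [h1, hbc]
      · simp [h1, h2]
  have key : ∀ {a' b' c' : U}, a' ≠ b' → a' ≠ c' → b' ≠ c' →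
      (Pi.single a' 1 + Pi.single b' 1 + Pi.single c' 1, 0) ∈ A →
      (Pi.single a 1 + Pi.single b 1 + Pi.single c 1, 0) ∈ A := by
    intro a' b' c' hab' hac' hbc' h
    rw [← ind hab' hac' hbc'] at h
    rw [← ind hab hac hbc]
    refine hA.move_finset hc _ _ _ rfl ?_ h
    rw [Finset.card_eq_three.2 ⟨_, _, _, hab', hac', hbc', rfl⟩,
      Finset.card_eq_three.2 ⟨_, _, _, hab, hac, hbc, rfl⟩]
  rcases SimpleGraph.exists_branching hH hc r with ⟨p, q, hp, hq, hpq⟩ |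
    ⟨c, d, p, q, hd, hp, hq, hdp, hdq, hpq⟩
  · exact key hp.ne hq.ne hpq (hA.star' hr hp hq hpq)
  · exact key hdp hdq hpq (hA.star hd hp hq hdp hdq hpq)

theorem xz_single_mem (hA : IsPauliClosed H A) (hc : H.Connected) (hH : ¬ H.IsBipartite) {r : U}
    (hr : (0, Pi.single r 1) ∈ A) (y : U → ZMod 2) : (y, Pi.single r 1) ∈ A := by
  -- `E` consists of the shifts of the `X`-part that preserve membership for strings with `Z`-part
  -- at `r`; the goal is that `E` is everything.
  let E : AddSubmonoid (U → ZMod 2) :=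
    { carrier := {y | ∀ x, (x, Pi.single r 1) ∈ A → (x + y, Pi.single r 1) ∈ A}
      zero_mem' := fun x hx => by simpa using hx
      add_mem' := fun {a b} ha hb x hx => by rw [← add_assoc]; exact hb _ (ha _ hx) }
  have hEr : Pi.single r 1 ∈ E := fun x hx => hA.toggle hx (by simp)
  have hE : ∀ {y : U → ZMod 2}, (y, 0) ∈ A → y r = 1 → y ∈ E := fun {y} hy hyr x hx =>
    hA.add_mem' hx hy (by simp [hyr]) rfl (by simp)
  have pair : ∀ b c, b ≠ r → c ≠ r → Pi.single b 1 + Pi.single c 1 ∈ E := by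
    intro b c hb hcr
    by_cases hbc : b = c
    · rw [hbc, zmodTwo_add_self]; exact E.zero_mem
    have h1 := E.add_mem hEr
      (hE (hA.triple_mem hc hH hr hb.symm hcr.symm hbc) (by simp [hb, hcr]))
    convert h1 using 1
    linear_combination -zmodTwo_add_self (Pi.single r 1 : U → ZMod 2)
  have single : ∀ b, Pi.single b 1 ∈ E := by
    intro b
    by_cases hb : b = r
    · rw [hb]; exact hEr
    -- The pairs in `E` preserve parity away from `r`. The odd walk supplies a string of odd parity,
    -- which pairs then reduce to the single token `b`.
    obtain ⟨p, hp⟩ := SimpleGraph.exists_odd_closed_walk hH hc r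
    obtain ⟨x, hx, hsum⟩ := hA.walk p hr
    replace hx := hA.exists_toggle hx (w := r) (by simp) 0
    rw [ZMod.natCast_eq_one_iff_odd.2 hp] at hsum
    generalize hx' : x + Pi.single r (x r + 0) = x' at hx
    have hxr : x' r = 0 := by rw [← hx']; simp [CharTwo.add_self_eq_zero]
    have hxs : ∑ i, x' i = 1 := by
      rw [← hx']
      simp only [Pi.add_apply, Finset.sum_add_distrib]
      simpa using hsum
    have h1 : ∑ i, (x' i • (Pi.single i 1 + Pi.single b 1) : U → ZMod 2) ∈ E := by
      refine E.sum_mem fun i _ => ?_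
      rcases zmodTwo_eq_zero_or_one (x' i) with h | h
      · rw [h, zero_smul]; exact E.zero_mem
      · rw [h, one_smul]
        refine pair i b ?_ hb
        rintro rfl
        rw [hxr] at h
        exact zero_ne_one h
    have h2 : ∑ i, (x' i • (Pi.single i 1 + Pi.single b 1) : U → ZMod 2) = x' + Pi.single b 1 := by
      simp_rw [smul_add, Finset.sum_add_distrib, ← Finset.sum_smul, hxs, one_smul]
      congr 1
      conv_rhs => rw [← Finset.univ_sum_single x']
      refine Finset.sum_congr rfl fun i _ => ?_
      rw [← Pi.single_smul, smul_eq_mul, mul_one]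
    rw [h2] at h1
    have h3 : (Pi.single b 1, Pi.single r 1) ∈ A := by
      have h4 := h1 _ hx
      convert h4 using 2
      linear_combination -zmodTwo_add_self x'
    have h5 : (Pi.single r 1 + Pi.single b 1, 0) ∈ A :=
      hA.add_mem' h3 (hA.toggle hr (w := r) (by simp)) (by simp [hb])
        (by rw [zero_add, add_comm]) (zmodTwo_add_self _).symm
    have h6 := E.add_mem hEr (hE h5 (by simp [hb]))
    convert h6 using 1
    linear_combination -zmodTwo_add_self (Pi.single r 1 : U → ZMod 2)
  have hy : y ∈ E := by
    rw [← Finset.univ_sum_single y]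
    refine E.sum_mem fun i _ => ?_
    rcases zmodTwo_eq_zero_or_one (y i) with h | h
    · rw [h, Pi.single_zero]; exact E.zero_mem
    · rw [h]; exact single i
  simpa using hy 0 hr

theorem x_string_mem (hA : IsPauliClosed H A) (hc : H.Connected) (hH : ¬ H.IsBipartite) {r : U}
    (hr : (0, Pi.single r 1) ∈ A) {y : U → ZMod 2} (hy : y ≠ 0) : (y, 0) ∈ A := by
  have key : ∀ y : U → ZMod 2, y r = 1 → (y, 0) ∈ A := fun y hyr =>
    hA.add_mem' (hA.xz_single_mem hc hH hr y) hr (by simp [hyr]) (by simp)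
      (zmodTwo_add_self _).symm
  rcases zmodTwo_eq_zero_or_one (y r) with h | h
  · obtain ⟨t, ht⟩ : ∃ t, y t ≠ 0 := Function.ne_iff.1 hy
    have ht1 : y t = 1 := (zmodTwo_eq_zero_or_one _).resolve_left ht
    have htr : t ≠ r := by rintro rfl; exact ht h
    obtain ⟨p⟩ := hc.preconnected r t
    -- The token at `t` is placed at `r`, where `key` applies, and then moved back.
    have h1 := hA.move p (key (y + Pi.single r 1 + Pi.single t 1) (by simp [h, htr.symm]))
      (by simp [h, htr.symm]) (by simp [ht1, htr]; rfl)
    convert h1 using 2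
    linear_combination -zmodTwo_add_self (Pi.single r 1 : U → ZMod 2) -
      zmodTwo_add_self (Pi.single t 1 : U → ZMod 2)
  · exact key y h

/-- For a connected graph that is not bipartite, a single extra label `Z_r` generates all labels. -/
theorem mem_of_ne_zero (hA : IsPauliClosed H A) (hc : H.Connected) (hH : ¬ H.IsBipartite) {r : U}
    (hr : (0, Pi.single r 1) ∈ A) {a : (U → ZMod 2) × (U → ZMod 2)} (ha : a ≠ 0) : a ∈ A := by
  -- An `X`-string shifts `x` by any vector pairing to 1 with `z`; a shift pairing to 0 needs one
  -- more toggle in the support of `z`.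
  have free : ∀ {x z : U → ZMod 2}, z ≠ 0 → (x, z) ∈ A → ∀ y, (y, z) ∈ A := by
    intro x z hz h y
    obtain ⟨t, ht⟩ : ∃ t, z t ≠ 0 := Function.ne_iff.1 hz
    have ht1 : z t = 1 := (zmodTwo_eq_zero_or_one _).resolve_left ht
    have odd : ∀ {y : U → ZMod 2}, z ⬝ᵥ y = 1 → (x + y, z) ∈ A := by
      intro y hy
      refine hA.add_mem' h (hA.x_string_mem hc hH hr (y := y) ?_) (by simp [hy]) rfl (by simp)
      rintro rfl
      simp at hy
    rcases zmodTwo_eq_zero_or_one (z ⬝ᵥ (x + y)) with h0 | h0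
    · have h1 := hA.toggle (odd (y := x + y + Pi.single t 1)
        (by rw [dotProduct_add, h0]; simp [ht1])) ht1
      convert h1 using 2
      linear_combination -zmodTwo_add_self x - zmodTwo_add_self (Pi.single t 1 : U → ZMod 2)
    · convert odd h0 using 2
      linear_combination -zmodTwo_add_self x
  let E : AddSubmonoid (U → ZMod 2) :=
    { carrier := {z | z ≠ 0 → (0, z) ∈ A}
      zero_mem' := fun h => absurd rfl h
      add_mem' := by
        intro z z' hz hz' hne
        by_cases h0 : z = 0
        · subst h0; rw [zero_add] at hne ⊢; exact hz' hne
        by_cases h0' : z' = 0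
        · subst h0'; rw [add_zero] at hne ⊢; exact hz hne
        obtain ⟨t, ht⟩ : ∃ t, z t ≠ 0 := Function.ne_iff.1 h0
        have ht1 : z t = 1 := (zmodTwo_eq_zero_or_one _).resolve_left ht
        -- Pure `Z`-strings commute, so one receives an auxiliary `X_t` to force anticommutation;
        -- `free` removes it afterwards.
        refine free hne (hA.add_mem (hz h0) (free h0' (hz' h0') (Pi.single t 1)) ?_) 0
        simp [ht1] }
  have single : ∀ w, Pi.single w 1 ∈ E := by
    intro w
    obtain ⟨p⟩ := hc.preconnected r w
    have hr' : Pi.single r 1 ∈ E := fun _ => hr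
    clear hr
    induction p with
    | nil => exact hr'
    | @cons c f e hadj p ih =>
      refine ih ?_
      have h1 := E.add_mem hr' (fun _ => hA.zz_mem hadj)
      convert h1 using 1
      linear_combination -zmodTwo_add_self (Pi.single c 1 : U → ZMod 2)
  obtain ⟨x, z⟩ := a
  by_cases hz : z = 0
  · subst hz
    refine hA.x_string_mem hc hH hr ?_
    rintro rfl
    exact ha rfl
  · refine free hz ((?_ : z ∈ E) hz) x
    rw [← Finset.univ_sum_single z]
    refine E.sum_mem fun i _ => ?_
    rcases zmodTwo_eq_zero_or_one (z i) with h | h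
    · rw [h, Pi.single_zero]; exact E.zero_mem
    · rw [h]; exact single i

end IsPauliClosed

end Combinatorics

/-! ### Pauli strings as matrices: brackets, traces and the expansion of operators. -/

section PauliStrings

/-- The sign `(-1)^a`. -/
noncomputable def zmodSign (a : ZMod 2) : ℂ := if a = 0 then 1 else -1

theorem zmodSign_zero : zmodSign 0 = 1 := by simp [zmodSign]

theorem zmodSign_one : zmodSign 1 = -1 := by simp [zmodSign]

theorem zmodSign_add (a b : ZMod 2) : zmodSign (a + b) = zmodSign a * zmodSign b := by
  rcases zmodTwo_eq_zero_or_one a with rfl | rfl <;>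
  rcases zmodTwo_eq_zero_or_one b with rfl | rfl <;>
  simp [zmodSign_zero, zmodSign_one, zmodTwo_one_add_one]

theorem star_zmodSign (a : ZMod 2) : star (zmodSign a) = zmodSign a := by
  rcases zmodTwo_eq_zero_or_one a with rfl | rfl <;> simp [zmodSign_zero, zmodSign_one]

/-- The phase that makes `X^x Z^z` skew-Hermitian, as a function of `x ⬝ᵥ z`. -/
noncomputable def pauliPhase (a : ZMod 2) : ℂ := if a = 0 then Complex.I else 1

theorem pauliPhase_zero : pauliPhase 0 = Complex.I := by simp [pauliPhase]

theorem pauliPhase_one : pauliPhase 1 = 1 := by simp [pauliPhase]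

theorem star_pauliPhase_mul_sign (a : ZMod 2) :
    star (pauliPhase a) * zmodSign a = -pauliPhase a := by
  rcases zmodTwo_eq_zero_or_one a with rfl | rfl <;>
  simp [pauliPhase_zero, pauliPhase_one, zmodSign_zero, zmodSign_one]

theorem star_pauliPhase_mul_self (a : ZMod 2) : star (pauliPhase a) * pauliPhase a = 1 := by
  rcases zmodTwo_eq_zero_or_one a with rfl | rfl <;> simp [pauliPhase_zero, pauliPhase_one]

/-- The shift by 1 is the change in `x ⬝ᵥ z` when anticommuting labels are added, so the bracket has
a real coefficient. -/
theorem pauliPhase_mul (a b : ZMod 2) : ∃ r : ℝ, r ≠ 0 ∧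
    pauliPhase a * pauliPhase b = r * pauliPhase (a + b + 1) := by
  rcases zmodTwo_eq_zero_or_one a with rfl | rfl <;>
  rcases zmodTwo_eq_zero_or_one b with rfl | rfl
  · exact ⟨-1, by norm_num, by simp [pauliPhase_zero, pauliPhase_one]⟩
  · exact ⟨1, by norm_num, by simp [pauliPhase_zero, pauliPhase_one, zmodTwo_one_add_one]⟩
  · exact ⟨1, by norm_num, by simp [pauliPhase_zero, pauliPhase_one, zmodTwo_one_add_one]⟩
  · exact ⟨1, by norm_num, by simp [pauliPhase_one, zmodTwo_one_add_one]⟩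

variable {U : Type*}

/-- Bit strings as vectors over the field with two elements. -/
def bits : BitString U ≃ (U → ZMod 2) := Equiv.refl _

theorem eq_add_comm_zmodTwo {s t x : U → ZMod 2} : s = t + x ↔ t = s + x := by
  constructor <;> (rintro rfl; rw [add_assoc, zmodTwo_add_self, add_zero])

variable [Fintype U]

/-- The real Pauli string `X^x Z^z`. -/
noncomputable def xzString (x z : U → ZMod 2) : QubitOp U :=
  Matrix.of fun s t => if bits s = bits t + x then zmodSign (z ⬝ᵥ bits t) else 0

/-- The skew-Hermitian Pauli string, a phase times `X^x Z^z`. -/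
noncomputable def skewPauli (x z : U → ZMod 2) : QubitOp U :=
  pauliPhase (x ⬝ᵥ z) • xzString x z

theorem xzString_apply (x z : U → ZMod 2) (s t : BitString U) :
    xzString x z s t = if bits s = bits t + x then zmodSign (z ⬝ᵥ bits t) else 0 := rfl

theorem conjTranspose_xzString (x z : U → ZMod 2) :
    (xzString x z)ᴴ = zmodSign (x ⬝ᵥ z) • xzString x z := by
  ext s t
  rw [Matrix.conjTranspose_apply, Matrix.smul_apply, xzString_apply, xzString_apply]
  simp only [eq_add_comm_zmodTwo (s := bits t)]
  split_ifs with h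
  · rw [star_zmodSign, smul_eq_mul, h, dotProduct_add, zmodSign_add, dotProduct_comm x z, mul_comm]
  · simp

theorem skewPauli_conjTranspose (x z : U → ZMod 2) : (skewPauli x z)ᴴ = -skewPauli x z := by
  rw [skewPauli, Matrix.conjTranspose_smul, conjTranspose_xzString, smul_smul,
    star_pauliPhase_mul_sign, neg_smul]

theorem xzString_z (z : U → ZMod 2) :
    xzString 0 z = Matrix.diagonal fun t : BitString U => zmodSign (z ⬝ᵥ bits t) := by
  ext s t
  simp only [xzString_apply, Matrix.diagonal_apply, add_zero, EmbeddingLike.apply_eq_iff_eq]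
  split_ifs with h
  · rw [h]
  · rfl

variable [DecidableEq U]

theorem xzString_mul (x z x' z' : U → ZMod 2) :
    xzString x z * xzString x' z' = zmodSign (z ⬝ᵥ x') • xzString (x + x') (z + z') := by
  ext s t
  rw [Matrix.mul_apply, Matrix.smul_apply, Finset.sum_eq_single (bits.symm (bits t + x'))]
  · simp only [xzString_apply, Equiv.apply_symm_apply, if_true, smul_eq_mul, dotProduct_add,
      add_dotProduct, zmodSign_add, add_assoc, add_comm x' x]
    split_ifs <;> ring
  · intro r _ hr
    rw [xzString_apply x' z' r t, if_neg, mul_zero]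
    rwa [Ne, Equiv.eq_symm_apply] at hr
  · simp

/-- Orthogonality of characters: translation by a basis vector in the support of `z` negates the
sum. -/
theorem sum_zmodSign_dotProduct (z : U → ZMod 2) :
    ∑ t : U → ZMod 2, zmodSign (z ⬝ᵥ t) = if z = 0 then (2 : ℂ) ^ Fintype.card U else 0 := by
  split_ifs with h
  · subst h
    simp [zmodSign_zero]
  · obtain ⟨k, hk⟩ : ∃ k, z k ≠ 0 := Function.ne_iff.1 h
    have hk1 : z k = 1 := (zmodTwo_eq_zero_or_one _).resolve_left hk
    have h1 : ∑ t : U → ZMod 2, zmodSign (z ⬝ᵥ t) =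
        ∑ t : U → ZMod 2, zmodSign (z ⬝ᵥ (t + Pi.single k 1)) :=
      (Equiv.sum_comp (Equiv.addRight (Pi.single k 1 : U → ZMod 2))
        fun t => zmodSign (z ⬝ᵥ t)).symm
    simp only [dotProduct_add, dotProduct_single, hk1, mul_one, zmodSign_add, zmodSign_one,
      mul_neg, Finset.sum_neg_distrib] at h1
    exact self_eq_neg.1 h1

theorem trace_xzString (x z : U → ZMod 2) (h : (x, z) ≠ 0) : (xzString x z).trace = 0 := by
  have h1 : (xzString x z).trace =
      ∑ t : U → ZMod 2, if t = t + x then zmodSign (z ⬝ᵥ t) else 0 :=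
    bits.sum_comp fun t => if t = t + x then zmodSign (z ⬝ᵥ t) else 0
  rw [h1]
  simp only [left_eq_add]
  split_ifs with hx
  · rw [sum_zmodSign_dotProduct, if_neg]
    rintro rfl
    exact h (by rw [hx]; rfl)
  · simp

theorem skewPauli_mem_su {x z : U → ZMod 2} (h : (x, z) ≠ 0) :
    skewPauli x z ∈ su (BitString U) :=
  ⟨skewPauli_conjTranspose x z, by rw [skewPauli, Matrix.trace_smul, trace_xzString x z h,
    smul_zero]⟩

theorem lie_skewPauli (x z x' z' : U → ZMod 2) :
    ⁅skewPauli x z, skewPauli x' z'⁆ = (pauliPhase (x ⬝ᵥ z) * pauliPhase (x' ⬝ᵥ z') *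
      (zmodSign (z ⬝ᵥ x') - zmodSign (x ⬝ᵥ z'))) • xzString (x + x') (z + z') := by
  rw [Ring.lie_def, skewPauli, skewPauli, Matrix.smul_mul, Matrix.mul_smul, Matrix.smul_mul,
    Matrix.mul_smul, xzString_mul, xzString_mul, add_comm x' x, add_comm z' z,
    dotProduct_comm z' x]
  simp only [smul_smul, ← sub_smul]
  congr 1
  ring

theorem lie_skewPauli_of_commute {x z x' z' : U → ZMod 2} (h : x ⬝ᵥ z' + z ⬝ᵥ x' = 0) :
    ⁅skewPauli x z, skewPauli x' z'⁆ = 0 := by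
  rw [lie_skewPauli, CharTwo.add_eq_zero.1 h, sub_self, mul_zero, zero_smul]

theorem lie_skewPauli_of_anticommute {x z x' z' : U → ZMod 2} (h : x ⬝ᵥ z' + z ⬝ᵥ x' = 1) :
    ∃ r : ℝ, r ≠ 0 ∧ ⁅skewPauli x z, skewPauli x' z'⁆ = r • skewPauli (x + x') (z + z') := by
  obtain ⟨r, hr, hr'⟩ := pauliPhase_mul (x ⬝ᵥ z) (x' ⬝ᵥ z')
  have h2 : (x + x') ⬝ᵥ (z + z') = x ⬝ᵥ z + x' ⬝ᵥ z' + 1 := by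
    rw [dotProduct_add, add_dotProduct, add_dotProduct, dotProduct_comm x' z, ← h]
    ring
  rw [lie_skewPauli, skewPauli, h2, hr']
  rcases zmodTwo_eq_zero_or_one (z ⬝ᵥ x') with h0 | h0
  · rw [h0, add_zero] at h
    refine ⟨r * 2, by simpa using hr, ?_⟩
    rw [h0, h, zmodSign_zero, zmodSign_one, ← smul_assoc]
    congr 1
    rw [Complex.real_smul]
    push_cast
    ring
  · have h3 : x ⬝ᵥ z' = 0 := by rw [h0] at h; simpa using h
    refine ⟨r * -2, by simpa using hr, ?_⟩
    rw [h0, h3, zmodSign_zero, zmodSign_one, ← smul_assoc]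
    congr 1
    rw [Complex.real_smul]
    push_cast
    ring

theorem xzString_single_x (w : U) : xzString (Pi.single w 1) 0 = pauliX w := by
  ext s t
  rw [xzString_apply, zero_dotProduct, zmodSign_zero, pauliX, onQubit, Matrix.of_apply]
  by_cases h : ∀ u, u ≠ w → s u = t u
  · rw [if_pos h]
    have h1 : bits s = bits t + Pi.single w 1 ↔ bits s w = bits t w + 1 := by
      constructor
      · intro h2; rw [h2]; simp
      · intro h2
        funext u
        by_cases hu : u = w
        · subst hu; rw [h2]; simp
        · rw [Pi.add_apply, Pi.single_eq_of_ne hu, add_zero]; exact h u hu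
    have h2 : ∀ a b : ZMod 2, (if a = b + 1 then (1 : ℂ) else 0) =
        (!![0, 1; 1, 0] : Matrix (Fin 2) (Fin 2) ℂ) (a : Fin 2) (b : Fin 2) := by
      intro a b
      rcases zmodTwo_eq_zero_or_one a with rfl | rfl <;>
      rcases zmodTwo_eq_zero_or_one b with rfl | rfl <;>
      simp [zmodTwo_one_add_one] <;> rfl
    simp only [h1]
    exact h2 (s w) (t w)
  · rw [if_neg h, if_neg]
    intro h1
    refine h fun u hu => ?_
    have h2 := congrFun h1 u
    rwa [Pi.add_apply, Pi.single_eq_of_ne hu, add_zero] at h2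

theorem skewPauli_x (w : U) : skewPauli (Pi.single w 1) 0 = Complex.I • pauliX w := by
  rw [skewPauli, dotProduct_zero, pauliPhase_zero, xzString_single_x]

theorem xzString_single (w : U) : xzString 0 (Pi.single w 1) = pauliZ w := by
  rw [xzString_z, pauliZ_eq_diagonal]
  congr 1
  funext t
  rw [single_dotProduct, one_mul]
  rfl

theorem skewPauli_z (w : U) : skewPauli 0 (Pi.single w 1) = Complex.I • pauliZ w := by
  rw [skewPauli, zero_dotProduct, pauliPhase_zero, xzString_single]

theorem skewPauli_zz (w u : U) :
    skewPauli 0 (Pi.single w 1 + Pi.single u 1) = Complex.I • pauliZZ s(w, u) := by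
  have h := xzString_mul 0 (Pi.single w 1) 0 (Pi.single u 1 : U → ZMod 2)
  rw [dotProduct_zero, zmodSign_zero, one_smul, add_zero, xzString_single, xzString_single] at h
  rw [skewPauli, zero_dotProduct, pauliPhase_zero, ← h]
  rfl

/-- Completeness of the Pauli basis: the entry position determines `x`, and the sum over `z` is a
character sum. -/
theorem sum_star_skewPauli_mul (s t s' t' : BitString U) :
    ∑ x : U → ZMod 2, ∑ z : U → ZMod 2, star (skewPauli x z s' t') * skewPauli x z s t =
      if s = s' ∧ t = t' then (2 : ℂ) ^ Fintype.card U else 0 := by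
  have h1 : ∀ x z : U → ZMod 2, star (skewPauli x z s' t') * skewPauli x z s t =
      if x = bits t + bits s ∧ x = bits t' + bits s' then
        zmodSign ((bits t + bits t') ⬝ᵥ z) else 0 := by
    intro x z
    have h2 : ∀ s t : BitString U, bits s = bits t + x ↔ x = bits t + bits s := by
      intro s t
      rw [add_comm, eq_add_comm_zmodTwo, add_comm]
    rw [skewPauli, Matrix.smul_apply, Matrix.smul_apply, xzString_apply, xzString_apply,
      smul_eq_mul, smul_eq_mul, star_mul', mul_mul_mul_comm, star_pauliPhase_mul_self, one_mul,
      ite_and, add_dotProduct, zmodSign_add, dotProduct_comm z, dotProduct_comm z]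
    simp only [h2]
    split_ifs <;> simp [star_zmodSign, mul_comm]
  simp_rw [h1]
  by_cases ht : t = t'
  · subst ht
    by_cases hs : s = s'
    · subst hs
      simp [zmodTwo_add_self, zmodSign_zero]
    · rw [if_neg fun h => hs h.1]
      refine Finset.sum_eq_zero fun x _ => Finset.sum_eq_zero fun z _ => if_neg ?_
      rintro ⟨rfl, h⟩
      exact hs (bits.injective (add_left_cancel h))
  · rw [if_neg fun h => ht h.2]
    refine Finset.sum_eq_zero fun x _ => ?_
    split_ifs
    · rw [sum_zmodSign_dotProduct, if_neg]
      intro h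
      apply ht
      apply bits.injective
      have := eq_add_comm_zmodTwo.1 ((add_comm _ _).trans h).symm
      rw [zero_add] at this
      exact this.symm
    · simp

theorem star_trace_mul_of_skew {A B : QubitOp U} (hA : Aᴴ = -A) (hB : Bᴴ = -B) :
    star (A * B).trace = (A * B).trace := by
  rw [← Matrix.trace_conjTranspose, Matrix.conjTranspose_mul, hA, hB, neg_mul_neg,
    Matrix.trace_mul_comm]

/-- The expansion of an operator in Pauli strings. -/
theorem sum_trace_smul_skewPauli (B : QubitOp U) :
    ∑ x : U → ZMod 2, ∑ z : U → ZMod 2, ((skewPauli x z)ᴴ * B).trace • skewPauli x z =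
      (2 : ℂ) ^ Fintype.card U • B := by
  ext s t
  have h1 : ∀ x z : U → ZMod 2, ((skewPauli x z)ᴴ * B).trace =
      ∑ t', ∑ s', star (skewPauli x z s' t') * B s' t' := fun x z => rfl
  simp only [Matrix.sum_apply, Matrix.smul_apply, smul_eq_mul, h1, Finset.sum_mul]
  calc _ = ∑ t', ∑ s', (∑ x : U → ZMod 2, ∑ z : U → ZMod 2,
          star (skewPauli x z s' t') * skewPauli x z s t) * B s' t' := by
        simp_rw [Finset.sum_mul]
        refine (Finset.sum_congr rfl fun x _ => Finset.sum_comm).trans ?_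
        rw [Finset.sum_comm]
        refine Finset.sum_congr rfl fun t' _ => ?_
        refine (Finset.sum_congr rfl fun x _ => Finset.sum_comm).trans ?_
        rw [Finset.sum_comm]
        refine Finset.sum_congr rfl fun s' _ => Finset.sum_congr rfl fun x _ =>
          Finset.sum_congr rfl fun z _ => ?_
        ring
    _ = _ := by
        simp_rw [sum_star_skewPauli_mul]
        rw [Finset.sum_eq_single t, Finset.sum_eq_single s]
        · simp
        · intro s' _ hs
          rw [if_neg fun h => hs h.1.symm, zero_mul]
        · simp
        · intro t' _ ht
          refine Finset.sum_eq_zero fun s' _ => ?_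
          rw [if_neg fun h => ht h.2.symm, zero_mul]
        · simp

/-- In the Pauli expansion of a traceless skew-Hermitian operator the coefficients are real and that
of the identity vanishes. -/
theorem su_le_of_skewPauli_mem {g : LieSubalgebra ℝ (QubitOp U)}
    (hg : ∀ x z : U → ZMod 2, (x, z) ≠ 0 → skewPauli x z ∈ g) : su (BitString U) ≤ g := by
  rintro B ⟨hB, hB'⟩
  have h1 : ∀ x z : U → ZMod 2, ((skewPauli x z)ᴴ * B).trace • skewPauli x z ∈ g := by
    intro x z
    by_cases h : (x, z) = 0
    · obtain ⟨rfl, rfl⟩ := Prod.mk_eq_zero.1 h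
      have h2 : (skewPauli 0 0 : QubitOp U) = Complex.I • 1 := by
        rw [skewPauli, zero_dotProduct, pauliPhase_zero, xzString_z]
        simp [zmodSign_zero]
      rw [h2]
      simp [hB']
    · have h2 := star_trace_mul_of_skew (skewPauli_conjTranspose x z) hB
      rw [← starRingEnd_apply, Complex.conj_eq_iff_real] at h2
      obtain ⟨r, hr⟩ := h2
      rw [skewPauli_conjTranspose, neg_mul, Matrix.trace_neg, hr, ← Complex.ofReal_neg]
      have h3 := g.smul_mem (-r) (hg x z h)
      rwa [← Complex.coe_smul] at h3
  have h2 : (2 : ℝ) ^ Fintype.card U • B ∈ g := by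
    have h3 := sum_trace_smul_skewPauli B
    have h4 : ((2 : ℝ) ^ Fintype.card U) • B = (2 : ℂ) ^ Fintype.card U • B := by
      rw [← Complex.coe_smul]
      push_cast
      rfl
    rw [h4, ← h3]
    exact sum_mem fun x _ => sum_mem fun z _ => h1 x z
  have h3 := g.smul_mem ((2 : ℝ) ^ Fintype.card U)⁻¹ h2
  rwa [smul_smul, inv_mul_cancel₀ (by positivity), one_smul] at h3

/-- The labels of the Pauli strings in a Lie algebra that contains the free dynamical Lie algebra
form a closed set. -/
theorem isPauliClosed_of_freeDLA_le {H : SimpleGraph U} {g : LieSubalgebra ℝ (QubitOp U)}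
    (hg : freeDLA H ≤ g) : IsPauliClosed H {a | skewPauli a.1 a.2 ∈ g} where
  add_mem := by
    intro x z x' z' h h' hω
    obtain ⟨r, hr, hr'⟩ := lie_skewPauli_of_anticommute hω
    have h1 := g.smul_mem r⁻¹ (g.lie_mem h h')
    rwa [hr', smul_smul, inv_mul_cancel₀ hr, one_smul] at h1
  x_mem w := hg (LieSubalgebra.subset_lieSpan (Or.inl ⟨w, skewPauli_x w⟩))
  zz_mem {w u} hwu :=
    hg (LieSubalgebra.subset_lieSpan (Or.inr ⟨s(w, u), hwu, skewPauli_zz w u⟩))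

end PauliStrings

/-! ### The reduced DLAs and their identification with `su`. -/

theorem freeReducedDLA_le_su {V : Type*} [Fintype V] [DecidableEq V] (G : SimpleGraph V) (v : V) :
    freeReducedDLA G v ≤ su (BitString {w : V // w ≠ v}) := by
  refine LieSubalgebra.lieSpan_le.2 ?_
  have single : ∀ w : {w : V // w ≠ v}, (Pi.single w 1 : {w : V // w ≠ v} → ZMod 2) ≠ 0 :=
    fun w => by simp
  rintro B ((⟨w, rfl⟩ | ⟨e, he, rfl⟩) | ⟨w, -, rfl⟩)
  · rw [← skewPauli_x]
    exact skewPauli_mem_su fun h => single w (Prod.mk_eq_zero.1 h).1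
  · induction e with
    | _ w u =>
      rw [← skewPauli_zz]
      refine skewPauli_mem_su fun h => ?_
      have h1 := congrFun (Prod.mk_eq_zero.1 h).2 w
      have hne : w ≠ u := SimpleGraph.Adj.ne ((reducedGraph G v).mem_edgeSet.1 he)
      simp [hne] at h1
  · rw [← skewPauli_z]
    exact skewPauli_mem_su fun h => single w (Prod.mk_eq_zero.1 h).2

theorem freeDLA_le_freeReducedDLA {V : Type*} [Fintype V] [DecidableEq V] (G : SimpleGraph V)
    (v : V) : freeDLA (reducedGraph G v) ≤ freeReducedDLA G v :=
  LieSubalgebra.lieSpan_mono Set.subset_union_left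

theorem stdReducedDLA_le_freeReducedDLA {V : Type*} [Fintype V] [DecidableEq V]
    (G : SimpleGraph V) [DecidableRel G.Adj] (v : V) :
    stdReducedDLA G v ≤ freeReducedDLA G v := by
  refine LieSubalgebra.lieSpan_le.2 ?_
  rintro B (rfl | rfl)
  · rw [reducedMixer, Finset.smul_sum]
    exact sum_mem fun w _ => LieSubalgebra.subset_lieSpan (Or.inl (Or.inl ⟨w, rfl⟩))
  · rw [reducedProblem, smul_add, Finset.smul_sum, Finset.smul_sum]
    refine add_mem (sum_mem fun e he => ?_) (sum_mem fun w hw => ?_)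
    · exact LieSubalgebra.subset_lieSpan
        (Or.inl (Or.inr ⟨e, SimpleGraph.mem_edgeFinset.1 he, rfl⟩))
    · exact LieSubalgebra.subset_lieSpan (Or.inr ⟨w, (Finset.mem_filter.1 hw).2, rfl⟩)

/-- If the standard reduced DLA contains the free DLA of the reduced graph, then it contains every
`i Z_w` for `w` adjacent to the removed vertex. -/
theorem pauliZ_mem_stdReducedDLA {V : Type*} [Fintype V] [DecidableEq V]
    (G : SimpleGraph V) [DecidableRel G.Adj] (v : V)
    (hcontain : freeDLA (reducedGraph G v) ≤ stdReducedDLA G v)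
    (w : {w : V // w ≠ v}) (hw : G.Adj v w.1) :
    Complex.I • pauliZ w ∈ stdReducedDLA G v := by
  have hA := isPauliClosed_of_freeDLA_le hcontain
  have hsum : ∑ u : {w : V // w ≠ v} with G.Adj v u.1, skewPauli 0 (Pi.single u 1) ∈
      stdReducedDLA G v := by
    have h1 : Complex.I • reducedProblem G v ∈ stdReducedDLA G v :=
      LieSubalgebra.subset_lieSpan (Or.inr rfl)
    have h2 : ∑ e ∈ (reducedGraph G v).edgeFinset, Complex.I • pauliZZ e ∈ stdReducedDLA G v :=
      sum_mem fun e he => hcontain (LieSubalgebra.subset_lieSpan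
        (Or.inr ⟨e, SimpleGraph.mem_edgeFinset.1 he, rfl⟩))
    have h3 := sub_mem h1 h2
    rw [reducedProblem, smul_add, Finset.smul_sum, Finset.smul_sum, add_sub_cancel_left] at h3
    simpa only [skewPauli_z] using h3
  have hx := hA.x_mem w
  -- Bracketing with `i X_w` kills every summand but `Z_w`, leaving a multiple of the string with
  -- `X` and `Z` at `w`; a second bracket restores `Z_w`.
  have h1 := (stdReducedDLA G v).lie_mem hx hsum
  obtain ⟨r, hr, hr'⟩ := lie_skewPauli_of_anticommute (x := Pi.single w 1) (z := 0) (x' := 0)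
    (z' := Pi.single w 1) (by simp)
  rw [lie_sum, Finset.sum_eq_single w, hr'] at h1
  · have h2 := (stdReducedDLA G v).smul_mem r⁻¹ h1
    rw [smul_smul, inv_mul_cancel₀ hr, one_smul] at h2
    have h3 := hA.add_mem' h2 hx (by simp) (y := 0) (t := Pi.single w 1)
      (by rw [add_zero, zmodTwo_add_self]) (by simp)
    rw [← skewPauli_z]
    exact h3
  · intro u _ hu
    exact lie_skewPauli_of_commute (by simp [hu.symm])
  · intro h
    exact absurd hw (by simpa using h)

theorem freeReducedDLA_le_stdReducedDLA {V : Type*} [Fintype V] [DecidableEq V]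
    (G : SimpleGraph V) [DecidableRel G.Adj] (v : V)
    (hcontain : freeDLA (reducedGraph G v) ≤ stdReducedDLA G v) :
    freeReducedDLA G v ≤ stdReducedDLA G v := by
  refine LieSubalgebra.lieSpan_le.2 (Set.union_subset
    (fun B hB => hcontain (LieSubalgebra.subset_lieSpan hB)) ?_)
  rintro B ⟨w, hw, rfl⟩
  exact pauliZ_mem_stdReducedDLA G v hcontain w hw

/-- The free reduced DLA is `su` of the reduced Hilbert space. -/
theorem freeReducedDLA_eq_su {V : Type*} [Fintype V] [DecidableEq V] (G : SimpleGraph V) (v : V)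
    (hG : G.Connected) (hconn : (reducedGraph G v).Connected)
    (hbip : ¬ (reducedGraph G v).IsBipartite) :
    freeReducedDLA G v = su (BitString {w : V // w ≠ v}) := by
  refine le_antisymm (freeReducedDLA_le_su G v) (su_le_of_skewPauli_mem fun x z hxz => ?_)
  -- A second vertex exists, so connectedness of `G` gives `v` a neighbour `r`, hence the generator
  -- `i Z_r`.
  obtain ⟨u⟩ := hconn.nonempty
  have : Nontrivial V := ⟨u.1, v, u.2⟩
  obtain ⟨r, hr⟩ := hG.preconnected.exists_adj_of_nontrivial v
  have hr' : skewPauli 0 (Pi.single (⟨r, hr.ne'⟩ : {w : V // w ≠ v}) 1) ∈ freeReducedDLA G v := by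
    rw [skewPauli_z]
    exact LieSubalgebra.subset_lieSpan (Or.inr ⟨⟨r, hr.ne'⟩, hr, rfl⟩)
  have hA := isPauliClosed_of_freeDLA_le (freeDLA_le_freeReducedDLA G v)
  exact hA.mem_of_ne_zero hconn hbip (a := (x, z)) hr' hxz

theorem reindex_mem_su {ι κ : Type*} [Fintype ι] [DecidableEq ι] [Fintype κ] [DecidableEq κ]
    (e : ι ≃ κ) {B : Matrix ι ι ℂ} (hB : B ∈ su ι) : Matrix.reindex e e B ∈ su κ := by
  refine ⟨?_, ?_⟩
  · rw [Matrix.conjTranspose_reindex, hB.1]; rfl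
  · exact (e.symm.sum_comp fun i => B i i).trans hB.2

/-- A bijection of index types induces an isomorphism of the Lie algebras `su`. -/
noncomputable def suEquivOfEquiv {ι κ : Type*} [Fintype ι] [DecidableEq ι] [Fintype κ]
    [DecidableEq κ] (e : ι ≃ κ) : su ι ≃ₗ⁅ℝ⁆ su κ where
  toFun B := ⟨Matrix.reindex e e B.1, reindex_mem_su e B.2⟩
  invFun B := ⟨Matrix.reindex e.symm e.symm B.1, reindex_mem_su e.symm B.2⟩
  map_add' _ _ := rfl
  map_smul' _ _ := rfl
  map_lie' := by
    intro B C
    apply Subtype.ext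
    simp only [LieSubalgebra.coe_bracket, Ring.lie_def, Matrix.reindex_apply,
      Matrix.submatrix_mul_equiv, Matrix.submatrix_sub, Pi.sub_apply]
  left_inv B := by
    apply Subtype.ext
    simp
  right_inv B := by
    apply Subtype.ext
    simp

theorem mainTheorem4 {V : Type*} [Fintype V] [DecidableEq V] (G : SimpleGraph V)
    [DecidableRel G.Adj] (v : V) (hG : G.Connected)
    (hconn : (reducedGraph G v).Connected)
    (hbip : ¬ (reducedGraph G v).IsBipartite)
    (hcycle : ¬ IsCycleGraph (reducedGraph G v))
    (hcontain : freeDLA (reducedGraph G v) ≤ stdReducedDLA G v) :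
    stdReducedDLA G v = freeReducedDLA G v ∧
      Nonempty (stdReducedDLA G v ≃ₗ⁅ℝ⁆ su (BitString {w : V // w ≠ v})) ∧
      Nonempty (su (BitString {w : V // w ≠ v}) ≃ₗ⁅ℝ⁆ su (Fin (2 ^ (Fintype.card V - 1)))) := by
  have h := le_antisymm (stdReducedDLA_le_freeReducedDLA G v)
    (freeReducedDLA_le_stdReducedDLA G v hcontain)
  refine ⟨h, ⟨LieEquiv.ofEq _ _ ?_⟩, ⟨suEquivOfEquiv (Fintype.equivFinOfCardEq ?_)⟩⟩
  · rw [h, freeReducedDLA_eq_su G v hG hconn hbip]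
  · rw [Fintype.card_fun, Fintype.card_fin, Fintype.card_subtype_compl, Fintype.card_subtype_eq]
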